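/- Let $k$ be a field and let $n\ge 4$ be an odd integer. Let $S$ be $k[x,y]$ or $k[[x,y]]$, put $f=x^2y+y^{n-1}$ and let $R=S/(f)$ be the corresponding curve singularity of type $D_n$. For a finitely generated $R$-module $M$ let $\underline{\mathrm{ann}}_R(M)$, its stable annihilator, be the annihilator in $R$ of the stable endomorphism ring $\mathrm{End}_R(M)/P(M,M)$, where $P(M,M)$ consists of the endomorphisms of $M$ that factor through a finitely generated projective $R$-module. For a matrix factorization $(\varphi,\psi)$ of $f$ over $S$ (square matrices with $\varphi\psi=\psi\varphi=f\cdot I$) write $\underline{\mathrm{ann}}(\varphi)=\underline{\mathrm{ann}}_R(\mathrm{coker}\,\varphi)$. Consider the matrix factorizations $(\varphi_j,\psi_j)$ and $(\xi_j,\eta_j)$ of $f$, $0\le j\le n-2$, given by $$\varphi_j=\begin{pmatrix} x & y^j\\ y^{n-j-2} & -x\end{pmatrix},\quad \psi_j=\begin{pmatrix} xy & y^{j+1}\\ y^{n-j-1} & -xy\end{pmatrix},\quad \xi_j=\begin{pmatrix} x & y^j\\ y^{n-j-1} & -xy\end{pmatrix},\quad \eta_j=\begin{pmatrix} xy & y^j\\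 y^{n-j-1} & -x\end{pmatrix}.$$ Then the following equalities of ideals of $R$ hold: $$\underline{\mathrm{ann}}(\varphi_j)=\underline{\mathrm{ann}}(\varphi_{n-j-2})=(x^2,\,xy,\,y^{j+1})\quad\text{for } 0<j<\tfrac{n-1}{2},$$ $$\underline{\mathrm{ann}}(\xi_j)=\underline{\mathrm{ann}}(\xi_{n-j-1})=(x,\,y^{j})\quad\text{for } 0<j\le\tfrac{n-1}{2}.$$ -/

import Mathlib

open Matrix

universe u v

section Stable

variable (R : Type u) [CommRing R] (M N : Type v) [AddCommGroup M] [Module R M]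
  [AddCommGroup N] [Module R N]

/-- A linear map factors through a projective module. All modules are finitely generated, so
that it is no restriction to take the projective module in the universe of the ring. -/
def FactorsThroughProjective {R : Type u} [CommRing R] {M N : Type v} [AddCommGroup M]
    [Module R M] [AddCommGroup N] [Module R N] (g : M →ₗ[R] N) : Prop :=
  ∃ (P : Type u) (_ : AddCommGroup P) (_ : Module R P),
    Module.Finite R P ∧ Module.Projective R P ∧
      ∃ (a : M →ₗ[R] P) (b : P →ₗ[R] N), g = b ∘ₗ a

/-- The submodule `P(M, N)` of `Hom_R(M, N)`: the maps that factor through a projective. -/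
def projHom : Submodule R (M →ₗ[R] N) where
  carrier := {g | FactorsThroughProjective g}
  zero_mem' := ⟨PUnit, inferInstance, inferInstance, inferInstance, inferInstance, 0, 0,
    by simp⟩
  add_mem' := by
    rintro _ _ ⟨P, _, _, _, _, a, b, rfl⟩ ⟨Q, _, _, _, _, c, d, rfl⟩
    exact ⟨P × Q, inferInstance, inferInstance, inferInstance, inferInstance, a.prod c,
      b.coprod d, by ext m; simp⟩
  smul_mem' := by
    rintro r _ ⟨P, _, _, _, _, a, b, rfl⟩
    exact ⟨P, inferInstance, inferInstance, inferInstance, inferInstance, a, r • b, by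
      ext m; simp⟩

/-- The stable endomorphisms `End_R(M) / P(M, M)`, with their `R`-module structure. -/
abbrev StableEnd : Type v := (M →ₗ[R] M) ⧸ projHom R M M

/-- The stable annihilator of `M`: the annihilator in `R` of the stable endomorphism ring. -/
noncomputable def stableAnn : Ideal R := Module.annihilator R (StableEnd R M)

end Stable

section MatrixFactorization

variable {S : Type u} [CommRing S] {ι : Type} [Fintype ι]

/-- The pair `(φ, ψ)` of square matrices is a matrix factorization of `f`. -/
def IsMatrixFactorization [DecidableEq ι] (f : S) (φ ψ : Matrix ι ι S) : Prop :=
  φ * ψ = f • (1 : Matrix ι ι S) ∧ ψ * φ = f • (1 : Matrix ι ι S)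

/-- The hypersurface ring `S / (f)`. -/
abbrev Hypersurface (f : S) : Type u := S ⧸ Ideal.span {f}

/-- The cokernel of a square matrix `φ` over `S`, as a module over `S / (f)`: the cokernel of
`φ` modulo `f`. When `φ` belongs to a matrix factorization of `f`, the cokernel of `φ` over `S`
is killed by `f` and is this module; see `ker_toMatCoker` and `toMatCoker_surjective`. -/
abbrev MatCoker (f : S) (φ : Matrix ι ι S) : Type u :=
  (ι → Hypersurface f) ⧸ LinearMap.range (φ.map (Ideal.Quotient.mk (Ideal.span {f}))).mulVecLin

/-- The natural `S`-linear map from the free module onto the cokernel. -/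
def toMatCoker (f : S) (φ : Matrix ι ι S) : (ι → S) →ₗ[S] MatCoker f φ :=
  ((Submodule.mkQ (LinearMap.range
      (φ.map (Ideal.Quotient.mk (Ideal.span {f}))).mulVecLin)).restrictScalars S) ∘ₗ
    (Algebra.linearMap S (Hypersurface f)).compLeft ι

theorem toMatCoker_surjective (f : S) (φ : Matrix ι ι S) :
    Function.Surjective (toMatCoker f φ) := by
  intro m
  obtain ⟨w, rfl⟩ := Submodule.mkQ_surjective _ m
  choose v hv using fun i => Ideal.Quotient.mk_surjective (w i)
  refine ⟨v, ?_⟩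
  have : w = fun i => Ideal.Quotient.mk (Ideal.span {f}) (v i) := funext fun i => (hv i).symm
  subst this
  rfl

theorem ker_toMatCoker [DecidableEq ι] {f : S} {φ ψ : Matrix ι ι S} (h : IsMatrixFactorization f φ ψ) :
    LinearMap.ker (toMatCoker f φ) = LinearMap.range φ.mulVecLin := by
  have key : ∀ u : ι → S, (φ.map (Ideal.Quotient.mk (Ideal.span {f}))) *ᵥ
      (fun i => Ideal.Quotient.mk (Ideal.span {f}) (u i)) =
      fun i => Ideal.Quotient.mk (Ideal.span {f}) ((φ *ᵥ u) i) := by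
    intro u
    ext i
    simp [Matrix.mulVec, dotProduct]
  ext v
  have e : toMatCoker f φ v = 0 ↔ (fun i => Ideal.Quotient.mk (Ideal.span {f}) (v i)) ∈
      LinearMap.range (φ.map (Ideal.Quotient.mk (Ideal.span {f}))).mulVecLin :=
    Submodule.Quotient.mk_eq_zero _
  rw [LinearMap.mem_ker, e]
  constructor
  · rintro ⟨w, hw⟩
    choose u hu using fun i => Ideal.Quotient.mk_surjective (w i)
    have hw' : w = fun i => Ideal.Quotient.mk (Ideal.span {f}) (u i) :=
      funext fun i => (hu i).symm
    subst hw'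
    rw [Matrix.mulVecLin_apply, key] at hw
    have hd : ∀ i, ∃ c, v i = (φ *ᵥ u) i + f * c := by
      intro i
      have := (Ideal.Quotient.mk_eq_mk_iff_sub_mem _ _).1 (congrFun hw i).symm
      obtain ⟨c, hc⟩ := Ideal.mem_span_singleton'.1 this
      exact ⟨c, by rw [mul_comm f c, hc]; ring⟩
    choose c hc using hd
    refine ⟨u + ψ *ᵥ c, ?_⟩
    rw [Matrix.mulVecLin_apply, Matrix.mulVec_add, Matrix.mulVec_mulVec, h.1,
      Matrix.smul_mulVec, Matrix.one_mulVec]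
    ext i
    simp [hc i]
  · rintro ⟨u, rfl⟩
    exact ⟨fun i => Ideal.Quotient.mk (Ideal.span {f}) (u i), key u⟩

end MatrixFactorization

section TypeD

variable {S : Type u} [CommRing S] (x y : S) (n j : ℕ)

/-- The `D_n` equation `x² y + y ^ (n - 1)`. -/
def dEq : S := x ^ 2 * y + y ^ (n - 1)

def dPhi : Matrix (Fin 2) (Fin 2) S := !![x, y ^ j; y ^ (n - j - 2), -x]

def dPsi : Matrix (Fin 2) (Fin 2) S := !![x * y, y ^ (j + 1); y ^ (n - j - 1), -(x * y)]

def dXi : Matrix (Fin 2) (Fin 2) S := !![x, y ^ j; y ^ (n - j - 1), -(x * y)]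

def dEta : Matrix (Fin 2) (Fin 2) S := !![x * y, y ^ j; y ^ (n - j - 1), -x]

theorem isMatrixFactorization_phi (h : j + 2 ≤ n) :
    IsMatrixFactorization (dEq x y n) (dPhi x y n j) (dPsi x y n j) := by
  obtain ⟨m, rfl⟩ := Nat.exists_eq_add_of_le h
  have h1 : j + 2 + m - j - 2 = m := by omega
  have h2 : j + 2 + m - j - 1 = m + 1 := by omega
  have h3 : j + 2 + m - 1 = j + m + 1 := by omega
  constructor <;> ext a b <;> fin_cases a <;> fin_cases b <;>
    simp [dEq, dPhi, dPsi, h1, h2, h3, Matrix.mul_apply, Fin.sum_univ_two] <;> ring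

theorem isMatrixFactorization_xi (h : j + 1 ≤ n) :
    IsMatrixFactorization (dEq x y n) (dXi x y n j) (dEta x y n j) := by
  obtain ⟨m, rfl⟩ := Nat.exists_eq_add_of_le h
  have h2 : j + 1 + m - j - 1 = m := by omega
  have h3 : j + 1 + m - 1 = j + m := by omega
  constructor <;> ext a b <;> fin_cases a <;> fin_cases b <;>
    simp [dEq, dXi, dEta, h2, h3, Matrix.mul_apply, Fin.sum_univ_two] <;> ring

/-- The ring `S / (x² y + y ^ (n - 1))`. -/
abbrev DRing : Type u := Hypersurface (dEq x y n)

/-- The image in `S / (x² y + y ^ (n - 1))` of an element of `S`. -/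
abbrev dMk : S →+* DRing x y n := Ideal.Quotient.mk (Ideal.span {dEq x y n})

/-- The stable annihilator over `S / (x² y + y ^ (n - 1))` of the cokernel of a matrix. -/
noncomputable def dAnn (φ : Matrix (Fin 2) (Fin 2) S) : Ideal (DRing x y n) :=
  stableAnn (DRing x y n) (MatCoker (dEq x y n) φ)

/-- The ideal `(x², x y, y ^ (j + 1))` of `S / (x² y + y ^ (n - 1))`. -/
def dIdealPhi : Ideal (DRing x y n) :=
  Ideal.span {dMk x y n (x ^ 2), dMk x y n (x * y), dMk x y n (y ^ (j + 1))}

/-- The ideal `(x, y ^ j)` of `S / (x² y + y ^ (n - 1))`. -/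
def dIdealXi : Ideal (DRing x y n) :=
  Ideal.span {dMk x y n x, dMk x y n (y ^ j)}

end TypeD

section Criterion

variable {S : Type u} [CommRing S] {ι : Type}

/-- `r` stably annihilates `M` exactly when multiplication by `r` factors through a projective. -/
theorem mem_stableAnn_iff {R : Type u} [CommRing R] {M : Type v} [AddCommGroup M] [Module R M]
    (r : R) :
    r ∈ stableAnn R M ↔ FactorsThroughProjective (r • (LinearMap.id : M →ₗ[R] M)) := by
  rw [stableAnn, Module.mem_annihilator]
  constructor
  · intro h
    have := h ((projHom R M M).mkQ LinearMap.id)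
    rw [← map_smul, Submodule.mkQ_apply, Submodule.Quotient.mk_eq_zero] at this
    exact this
  · rintro ⟨P, _, _, hf, hp, a, b, hab⟩ m
    obtain ⟨g, rfl⟩ := Submodule.mkQ_surjective _ m
    rw [← map_smul, Submodule.mkQ_apply, Submodule.Quotient.mk_eq_zero]
    refine ⟨P, _, _, hf, hp, a, g ∘ₗ b, ?_⟩
    rw [LinearMap.comp_assoc, ← hab]
    ext
    simp

/-- A matrix over `S` that vanishes over `S / (f)` is a multiple of `f`. -/
theorem exists_eq_smul_of_map_eq_zero {f : S} {A : Matrix ι ι S}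
    (h : A.map (Ideal.Quotient.mk (Ideal.span {f})) = 0) : ∃ C : Matrix ι ι S, A = f • C := by
  have hd : ∀ i j, ∃ c, A i j = f * c := fun i j =>
    Ideal.mem_span_singleton.1 (Ideal.Quotient.eq_zero_iff_mem.1 (congrFun (congrFun h i) j))
  choose c hc using hd
  exact ⟨c, by ext i j; exact hc i j⟩

theorem exists_map_mk_eq {f : S} (A : Matrix ι ι (Hypersurface f)) :
    ∃ B : Matrix ι ι S, B.map (Ideal.Quotient.mk (Ideal.span {f})) = A := by
  choose B hB using fun i j => Ideal.Quotient.mk_surjective (A i j)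
  exact ⟨B, by ext i j; exact hB i j⟩

/-- Multiplication by `r` is stably zero on the cokernel of `φ` exactly when `r` is null-homotopic
on the matrix factorization `(φ, ψ)`. -/
theorem mk_mem_stableAnn_matCoker_iff [Fintype ι] [DecidableEq ι] {f : S} {φ ψ : Matrix ι ι S}
    (h : IsMatrixFactorization f φ ψ) (hf : IsLeftRegular f) (r : S) :
    Ideal.Quotient.mk (Ideal.span {f}) r ∈ stableAnn (Hypersurface f) (MatCoker f φ) ↔
      ∃ B C : Matrix ι ι S, r • (1 : Matrix ι ι S) = φ * C + B * ψ := by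
  set q := Ideal.Quotient.mk (Ideal.span {f})
  have hqf : q f = 0 := Ideal.Quotient.eq_zero_iff_mem.2 (Ideal.mem_span_singleton_self f)
  have hmap : ∀ (s : S) (A : Matrix ι ι S), (s • A).map q = q s • A.map q := fun s A => by
    ext i j; simp
  rw [mem_stableAnn_iff]
  constructor
  · rintro ⟨P, _, _, _, _, a, b, hab⟩
    obtain ⟨b', hb'⟩ := Module.projective_lifting_property
      (Submodule.mkQ (LinearMap.range (φ.map q).mulVecLin)) b (Submodule.mkQ_surjective _)
    let g : (ι → Hypersurface f) →ₗ[Hypersurface f] (ι → Hypersurface f) :=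
      b' ∘ₗ a ∘ₗ Submodule.mkQ (LinearMap.range (φ.map q).mulVecLin)
    obtain ⟨A, hA⟩ := exists_map_mk_eq (LinearMap.toMatrix' g)
    have hAg : ∀ w, A.map q *ᵥ w = g w := fun w => by
      rw [hA, LinearMap.toMatrix'_mulVec]
    have hAφ : (A * φ).map q = 0 := by
      rw [Matrix.map_mul]
      refine Matrix.ext_of_mulVec_single fun i => ?_
      rw [← Matrix.mulVec_mulVec, hAg, Matrix.zero_mulVec]
      have : (Submodule.mkQ (LinearMap.range (φ.map q).mulVecLin))
          (φ.map q *ᵥ Pi.single i 1) = 0 :=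
        (Submodule.Quotient.mk_eq_zero _).2 ⟨_, rfl⟩
      simp only [g, LinearMap.comp_apply, this, map_zero]
    obtain ⟨B, hB⟩ := exists_eq_smul_of_map_eq_zero hAφ
    have hAB : A = B * ψ := by
      have : f • A = f • (B * ψ) := by
        rw [← Matrix.smul_mul, ← hB, Matrix.mul_assoc, h.1, Matrix.mul_smul, Matrix.mul_one]
      ext i j
      exact hf (congrFun (congrFun this i) j)
    have hrange : ∀ i, ∃ w, φ.map q *ᵥ w =
        q r • Pi.single i (1 : Hypersurface f) - A.map q *ᵥ Pi.single i 1 := by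
      intro i
      have := LinearMap.congr_fun hab
        ((Submodule.mkQ (LinearMap.range (φ.map q).mulVecLin)) (Pi.single i 1))
      rw [← hb', LinearMap.smul_apply, LinearMap.id_apply, ← map_smul] at this
      obtain ⟨w, hw⟩ := (Submodule.Quotient.eq _).1 this
      exact ⟨w, by rw [hAg]; exact hw⟩
    choose w hw using hrange
    obtain ⟨W, hW⟩ := exists_map_mk_eq (f := f) (Matrix.of w)ᵀ
    have hzero : (r • (1 : Matrix ι ι S) - A - φ * W).map q = 0 := by
      rw [Matrix.map_sub q (map_sub q), Matrix.map_sub q (map_sub q), hmap, Matrix.map_mul, hW,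
        Matrix.map_one q (map_zero q) (map_one q)]
      refine Matrix.ext_of_mulVec_single fun i => ?_
      have hcol : (Matrix.of w)ᵀ *ᵥ Pi.single i 1 = w i := by
        ext k; simp
      rw [Matrix.sub_mulVec, Matrix.sub_mulVec, ← Matrix.mulVec_mulVec, hcol, hw,
        Matrix.smul_mulVec, Matrix.one_mulVec, sub_self, Matrix.zero_mulVec]
    obtain ⟨D, hD⟩ := exists_eq_smul_of_map_eq_zero hzero
    refine ⟨B, W + ψ * D, ?_⟩
    rw [Matrix.mul_add, ← Matrix.mul_assoc, h.1, Matrix.smul_mul, Matrix.one_mul, ← hD, ← hAB]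
    abel
  · rintro ⟨B, C, hBC⟩
    have hker : LinearMap.range (φ.map q).mulVecLin ≤
        LinearMap.ker ((B * ψ).map q).mulVecLin := by
      rintro _ ⟨w, rfl⟩
      rw [LinearMap.mem_ker, Matrix.mulVecLin_apply, Matrix.mulVecLin_apply, Matrix.mulVec_mulVec,
        ← Matrix.map_mul, Matrix.mul_assoc, h.2, Matrix.mul_smul, Matrix.mul_one, hmap, hqf,
        zero_smul, Matrix.zero_mulVec]
    refine ⟨ι → Hypersurface f, _, _, inferInstance, inferInstance,
      Submodule.liftQ _ _ hker, Submodule.mkQ _, ?_⟩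
    refine Submodule.linearMap_qext _ (LinearMap.ext fun w => ?_)
    refine (Submodule.Quotient.eq _).2 ⟨C.map q *ᵥ w, ?_⟩
    have := congrArg (fun A => A.map q *ᵥ w) hBC
    simp only [hmap, Matrix.map_one q (map_zero q) (map_one q), Matrix.map_add q (map_add q),
      Matrix.add_mulVec, Matrix.smul_mulVec, Matrix.one_mulVec] at this
    change φ.map q *ᵥ (C.map q *ᵥ w) = q r • w - (B * ψ).map q *ᵥ w
    rw [this, Matrix.mulVec_mulVec, Matrix.map_mul, add_sub_cancel_right]

end Criterion

section TypeD

variable {S : Type u} [CommRing S] {x y : S}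

/-- The solutions of `x u = y ^ a v` when `x` is prime and does not divide `y`. -/
theorem Prime.exists_eq_mul_of_mul_eq_pow_mul [IsDomain S] (hx : Prime x) (hxy : ¬ x ∣ y) {a : ℕ}
    {u v : S} (h : x * u = y ^ a * v) : ∃ t, u = y ^ a * t ∧ v = x * t := by
  obtain ⟨t, rfl⟩ := (hx.dvd_or_dvd (Dvd.intro u h)).resolve_left fun h => hxy (hx.dvd_of_dvd_pow h)
  exact ⟨t, mul_left_cancel₀ hx.ne_zero (by rw [h]; ring), rfl⟩

theorem isLeftRegular_dEq [IsDomain S] (hx : Prime x) (hxy : ¬ x ∣ y) (n : ℕ) :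
    IsLeftRegular (dEq x y n) := by
  refine (IsRegular.of_ne_zero fun h => hxy (hx.dvd_of_dvd_pow (n := n - 1) ?_)).left
  rw [dEq] at h
  exact ⟨-(x * y), by linear_combination h⟩

/-- An equality of `2 × 2` matrices `r • 1 = φ C + B ψ`, entry by entry. -/
theorem smul_one_eq_mul_add_mul_iff (r p q s t p' q' s' t' b₀ b₁ b₂ b₃ c₀ c₁ c₂ c₃ : S) :
    r • (1 : Matrix (Fin 2) (Fin 2) S) =
        !![p, q; s, t] * !![c₀, c₁; c₂, c₃] + !![b₀, b₁; b₂, b₃] * !![p', q'; s', t'] ↔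
      (r = p * c₀ + q * c₂ + (b₀ * p' + b₁ * s') ∧ 0 = p * c₁ + q * c₃ + (b₀ * q' + b₁ * t')) ∧
      0 = s * c₀ + t * c₂ + (b₂ * p' + b₃ * s') ∧ r = s * c₁ + t * c₃ + (b₂ * q' + b₃ * t') := by
  simp [← Matrix.ext_iff, Fin.forall_fin_two]

theorem dAnn_dPhi [IsDomain S] (hx : Prime x) (hxy : ¬ x ∣ y) {n j i : ℕ} (hi : i + 2 ≤ n)
    (hij : i = j ∨ n - i - 2 = j) (hji : j ≤ i) (hjn : j ≤ n - i - 2) (hj : 0 < j) :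
    dAnn x y n (dPhi x y n i) = dIdealPhi x y n j := by
  have key := mk_mem_stableAnn_matCoker_iff (isMatrixFactorization_phi x y n i hi)
    (isLeftRegular_dEq hx hxy n)
  obtain ⟨b, hb⟩ : ∃ b, n - i - 2 = b := ⟨_, rfl⟩
  have hb' : n - i - 1 = b + 1 := by omega
  rw [dPhi, dPsi, hb, hb'] at key
  rw [hb] at hjn hij
  rw [dAnn, dPhi, hb]
  apply le_antisymm
  · intro r hr
    obtain ⟨r, rfl⟩ := Ideal.Quotient.mk_surjective r
    obtain ⟨B, C, hBC⟩ := (key r).1 hr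
    rw [Matrix.eta_fin_two B, Matrix.eta_fin_two C, smul_one_eq_mul_add_mul_iff] at hBC
    obtain ⟨⟨h1, -⟩, h3, -⟩ := hBC
    obtain ⟨t, ht, ht'⟩ := Prime.exists_eq_mul_of_mul_eq_pow_mul hx hxy (a := b)
      (u := C 1 0 - y * B 1 0) (v := C 0 0 + y * B 1 1) (by linear_combination h3)
    obtain ⟨d, rfl⟩ := Nat.exists_eq_add_of_le hji
    obtain ⟨e, rfl⟩ := Nat.exists_eq_add_of_le hjn
    obtain ⟨j, rfl⟩ := Nat.exists_eq_add_of_le' hj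
    have hr : r = t * x ^ 2 + (B 0 0 - B 1 1) * (x * y) +
        (y ^ d * B 1 0 + y ^ e * B 0 1 + y ^ (d + e + j) * t) * y ^ (j + 1 + 1) := by
      linear_combination h1 + x * ht' + y ^ (j + 1 + d) * ht
    rw [hr, map_add, map_add]
    refine add_mem (add_mem ?_ ?_) ?_ <;> rw [map_mul] <;>
      refine Ideal.mul_mem_left _ _ (Ideal.subset_span ?_)
    exacts [Or.inl rfl, Or.inr (Or.inl rfl), Or.inr (Or.inr rfl)]
  · rw [dIdealPhi, Ideal.span_le]
    rintro _ (rfl | rfl | rfl)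
    · refine (key _).2 ⟨!![0, 0; -(y ^ (b - 1)), 0], !![x, y ^ i; 0, -x], ?_⟩
      obtain ⟨b, rfl⟩ := Nat.exists_eq_add_of_le' (hj.trans_le hjn)
      rw [smul_one_eq_mul_add_mul_iff, Nat.add_succ_sub_one, Nat.add_zero]
      refine ⟨⟨?_, ?_⟩, ?_, ?_⟩ <;> ring
    · refine (key _).2 ⟨!![1, 0; 0, 0], !![0, 0; 0, -y], ?_⟩
      rw [smul_one_eq_mul_add_mul_iff]
      refine ⟨⟨?_, ?_⟩, ?_, ?_⟩ <;> ring
    · refine (key _).2 ?_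
      obtain rfl | rfl := hij
      · refine ⟨!![0, 0; 1, 0], !![0, 0; y, 0], ?_⟩
        rw [smul_one_eq_mul_add_mul_iff]
        refine ⟨⟨?_, ?_⟩, ?_, ?_⟩ <;> ring
      · refine ⟨!![0, 1; 0, 0], !![0, y; 0, 0], ?_⟩
        rw [smul_one_eq_mul_add_mul_iff]
        refine ⟨⟨?_, ?_⟩, ?_, ?_⟩ <;> ring

theorem dAnn_dXi [IsDomain S] (hx : Prime x) (hxy : ¬ x ∣ y) {n j i : ℕ} (hi : i + 1 ≤ n)
    (hij : i = j ∨ n - i - 1 = j) (hji : j ≤ i) (hjn : j ≤ n - i - 1) :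
    dAnn x y n (dXi x y n i) = dIdealXi x y n j := by
  have key := mk_mem_stableAnn_matCoker_iff (isMatrixFactorization_xi x y n i hi)
    (isLeftRegular_dEq hx hxy n)
  obtain ⟨b, hb⟩ : ∃ b, n - i - 1 = b := ⟨_, rfl⟩
  rw [dXi, dEta, hb] at key
  rw [hb] at hjn hij
  rw [dAnn, dXi, hb]
  apply le_antisymm
  · intro r hr
    obtain ⟨r, rfl⟩ := Ideal.Quotient.mk_surjective r
    obtain ⟨B, C, hBC⟩ := (key r).1 hr
    rw [Matrix.eta_fin_two B, Matrix.eta_fin_two C, smul_one_eq_mul_add_mul_iff] at hBC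
    obtain ⟨⟨-, h2⟩, -, h4⟩ := hBC
    obtain ⟨t, ht, ht'⟩ := Prime.exists_eq_mul_of_mul_eq_pow_mul hx hxy (a := i)
      (u := C 0 1 - B 0 1) (v := - C 1 1 - B 0 0) (by linear_combination -h2)
    obtain ⟨d, rfl⟩ := Nat.exists_eq_add_of_le hji
    obtain ⟨e, rfl⟩ := Nat.exists_eq_add_of_le hjn
    have hr : r = (y * B 0 0 + x * y * t - B 1 1) * x +
        (y ^ e * B 0 1 + y ^ d * B 1 0 + y ^ (j + d + e) * t) * y ^ j := by
      linear_combination h4 + y ^ (j + e) * ht + x * y * ht'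
    rw [hr, map_add, map_mul, map_mul]
    refine add_mem ?_ ?_ <;> exact Ideal.mul_mem_left _ _ (Ideal.subset_span (by simp))
  · rw [dIdealXi, Ideal.span_le]
    rintro _ (rfl | rfl)
    · refine (key _).2 ⟨!![0, 0; 0, -1], !![1, 0; 0, 0], ?_⟩
      rw [smul_one_eq_mul_add_mul_iff]
      refine ⟨⟨?_, ?_⟩, ?_, ?_⟩ <;> ring
    · refine (key _).2 ?_
      obtain rfl | rfl := hij
      · refine ⟨!![0, 0; 1, 0], !![0, 0; 1, 0], ?_⟩
        rw [smul_one_eq_mul_add_mul_iff]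
        refine ⟨⟨?_, ?_⟩, ?_, ?_⟩ <;> ring
      · refine ⟨!![0, 1; 0, 0], !![0, 1; 0, 0], ?_⟩
        rw [smul_one_eq_mul_add_mul_iff]
        refine ⟨⟨?_, ?_⟩, ?_, ?_⟩ <;> ring

theorem dAnn_dPhi_and_dAnn_dXi [IsDomain S] (hx : Prime x) (hxy : ¬ x ∣ y) (n : ℕ) (hn : Odd n) :
    (∀ j : ℕ, 0 < j → j < (n - 1) / 2 →
      dAnn x y n (dPhi x y n j) = dIdealPhi x y n j ∧
      dAnn x y n (dPhi x y n (n - j - 2)) = dIdealPhi x y n j) ∧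
    (∀ j : ℕ, 0 < j → j ≤ (n - 1) / 2 →
      dAnn x y n (dXi x y n j) = dIdealXi x y n j ∧
      dAnn x y n (dXi x y n (n - j - 1)) = dIdealXi x y n j) := by
  obtain ⟨m, rfl⟩ := hn
  refine ⟨fun j hj hjn => ⟨dAnn_dPhi hx hxy ?_ ?_ ?_ ?_ hj, dAnn_dPhi hx hxy ?_ ?_ ?_ ?_ hj⟩,
    fun j hj hjn => ⟨dAnn_dXi hx hxy ?_ ?_ ?_ ?_, dAnn_dXi hx hxy ?_ ?_ ?_ ?_⟩⟩ <;> omega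

end TypeD

section Variables

variable {σ k : Type*} [Field k]

theorem MvPowerSeries.not_X_dvd_X {s t : σ} (hst : s ≠ t) :
    ¬ (X s : MvPowerSeries σ k) ∣ X t := by
  classical
  intro h
  have := X_dvd_iff.1 h (Finsupp.single t 1) (by simp [hst.symm])
  simp [coeff_X] at this

theorem MvPowerSeries.prime_X (s : σ) : Prime (X s : MvPowerSeries σ k) := by
  classical
  let e : {i // i ≠ s} ↪ σ := Function.Embedding.subtype _
  have hker : ∀ φ : MvPowerSeries σ k, X s ∣ φ ↔ killCompl e φ = 0 := by
    intro φ
    rw [X_dvd_iff, MvPowerSeries.ext_iff]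
    constructor
    · intro h m
      rw [coeff_killCompl, h, map_zero]
      refine Finsupp.embDomain_of_notMem_range _ _ _ ?_
      rintro ⟨i, hi⟩
      exact i.2 hi
    · intro h m hm
      have := h (m.comapDomain e e.injective.injOn)
      rw [coeff_killCompl, map_zero, Finsupp.embDomain_comapDomain] at this
      · exact this
      · intro i hi
        refine ⟨⟨i, ?_⟩, rfl⟩
        rintro rfl
        exact Finsupp.mem_support_iff.1 hi hm
  refine ⟨fun h => ?_, fun h => ?_, fun a b h => ?_⟩
  · have := congrArg (coeff (Finsupp.single s 1)) h
    simp [coeff_X] at this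
  · have := (hker 1).1 h.dvd
    simp at this
  · rw [hker, map_mul, mul_eq_zero] at h
    rwa [hker, hker]

end Variables

/-- The first two parts are about `k[x, y] / (x² y + y ^ (n - 1))`, the last two about its
complete local version `k[[x, y]] / (x² y + y ^ (n - 1))`. Since `n` is odd, `(n - 1) / 2` is
an exact division. -/
theorem proposition5p4 {k : Type u} [Field k] (n : ℕ) (hn : Odd n) (hn4 : 4 ≤ n) :
    (∀ x y : MvPolynomial (Fin 2) k, x = MvPolynomial.X 0 → y = MvPolynomial.X 1 →
      (∀ j : ℕ, 0 < j → j < (n - 1) / 2 →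
        dAnn x y n (dPhi x y n j) = dIdealPhi x y n j ∧
        dAnn x y n (dPhi x y n (n - j - 2)) = dIdealPhi x y n j) ∧
      (∀ j : ℕ, 0 < j → j ≤ (n - 1) / 2 →
        dAnn x y n (dXi x y n j) = dIdealXi x y n j ∧
        dAnn x y n (dXi x y n (n - j - 1)) = dIdealXi x y n j)) ∧
    (∀ x y : MvPowerSeries (Fin 2) k, x = MvPowerSeries.X 0 → y = MvPowerSeries.X 1 →
      (∀ j : ℕ, 0 < j → j < (n - 1) / 2 →
        dAnn x y n (dPhi x y n j) = dIdealPhi x y n j ∧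
        dAnn x y n (dPhi x y n (n - j - 2)) = dIdealPhi x y n j) ∧
      (∀ j : ℕ, 0 < j → j ≤ (n - 1) / 2 →
        dAnn x y n (dXi x y n j) = dIdealXi x y n j ∧
        dAnn x y n (dXi x y n (n - j - 1)) = dIdealXi x y n j)) := by
  constructor
  · rintro _ _ rfl rfl
    exact dAnn_dPhi_and_dAnn_dXi (MvPolynomial.X_prime) (by simp [MvPolynomial.X_dvd_X]) n hn
  · rintro _ _ rfl rfl
    have : IsDomain (MvPowerSeries (Fin 2) k) := NoZeroDivisors.to_isDomain _
    exact dAnn_dPhi_and_dAnn_dXi (MvPowerSeries.prime_X 0)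
      (MvPowerSeries.not_X_dvd_X zero_ne_one) n hn
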